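/- Let $n\ge 0$ be an integer, let $\sigma>0$, and let $X$ be a random vector in $\mathbb{R}^n$ that is sub-Gaussian with variance proxy $\sigma^2$, i.e. $$\mathbb{E}\,e^{\lambda\langle \ell,X\rangle}\le e^{\lambda^2\sigma^2/2}\qquad\text{for all }\lambda\in\mathbb{R}\text{ and all }\ell\in\mathbb{R}^n\text{ with }\|\ell\|=1,$$ where $\langle\cdot,\cdot\rangle$ and $\|\cdot\|$ are the Euclidean inner product and norm. Then: (1) for every $\delta\in(0,1)$ and every $\varepsilon\in(0,1)$, $$\mathbb{P}\left(\|X\|\le \sigma\sqrt{\frac{\log\frac{1}{1-\varepsilon^2}}{\varepsilon^2}\,n+\frac{2}{\varepsilon^2}\log\frac1\delta}\right)\ge 1-\delta;$$ (2) for every $\varepsilon\in(0,1)$ and every $t\in\mathbb{R}$, the variable $e^{t\|X\|}$ is integrable and $$\mathbb{E}\,e^{t\|X\|}\le (1-\varepsilon^2)^{-n/2}\exp\left(\frac{\sigma^2t^2}{2\varepsilon^2}\right).$$ -/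

import Mathlib

open MeasureTheory ProbabilityTheory
open scoped NNReal

/-- A random vector `X` in `ℝⁿ` is sub-Gaussian with variance proxy `v` under `μ` if for every
Euclidean unit vector `ℓ` the real random variable `⟨ℓ, X⟩` is sub-Gaussian with variance proxy `v`,
that is, for every real `r` the variable `exp (r * ⟨ℓ, X⟩)` is integrable and
`𝔼[exp (r * ⟨ℓ, X⟩)] ≤ exp (v * r ^ 2 / 2)`. -/
structure IsSubGaussianVector {Ω : Type*} [MeasurableSpace Ω] {n : ℕ}
    (X : Ω → EuclideanSpace ℝ (Fin n)) (v : ℝ≥0) (μ : Measure Ω) : Prop where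
  aemeasurable : AEMeasurable X μ
  hasSubgaussianMGF_inner : ∀ ℓ : EuclideanSpace ℝ (Fin n), ‖ℓ‖ = 1 →
    HasSubgaussianMGF (fun ω => inner ℝ ℓ (X ω)) v μ

/-! Gaussian linearization: for `g` standard Gaussian independent of `X`, `exp (s² ‖X‖² / 2)` is the
`g`-average of `exp (s ⟨X, g⟩)`. Swapping the integrals and using sub-Gaussianity for fixed `g`
leaves a Gaussian integral, equal to `(1 - s² v) ^ (-n / 2)`. With `v = σ²` and `s = ε / σ`,
Markov's inequality gives (1) and Young's inequality gives (2). -/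

open Real in
/-- The Laplace transform of the Gaussian weight `exp (-b * ‖g‖ ^ 2)` on `ℝⁿ`. -/
lemma lintegral_exp_neg_mul_sq_norm_add_inner {n : ℕ} {b : ℝ} (hb : 0 < b)
    (w : EuclideanSpace ℝ (Fin n)) :
    ∫⁻ g : EuclideanSpace ℝ (Fin n), ENNReal.ofReal (exp (-b * ‖g‖ ^ 2 + inner ℝ w g)) =
      ENNReal.ofReal ((π / b) ^ ((n : ℝ) / 2) * exp (‖w‖ ^ 2 / (4 * b))) := by
  have hb' : 0 < (b : ℂ).re := by simpa using hb
  have hcast : ∀ g : EuclideanSpace ℝ (Fin n),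
      Complex.exp (-(b : ℂ) * (‖g‖ : ℂ) ^ 2 + 1 * ((inner ℝ w g : ℝ) : ℂ)) =
        ((exp (-b * ‖g‖ ^ 2 + inner ℝ w g) : ℝ) : ℂ) := fun g => by
    push_cast
    rw [one_mul]
  have hint := GaussianFourier.integrable_cexp_neg_mul_sq_norm_add hb' 1 w
  have hval := GaussianFourier.integral_cexp_neg_mul_sq_norm_add hb' 1 w
  simp_rw [hcast] at hint hval
  have hint' : Integrable (fun g : EuclideanSpace ℝ (Fin n) =>
      exp (-b * ‖g‖ ^ 2 + inner ℝ w g)) := by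
    simpa only [RCLike.re_to_complex, Complex.ofReal_re] using hint.re
  rw [integral_complex_ofReal] at hval
  rw [← ofReal_integral_eq_lintegral_ofReal hint' (ae_of_all _ fun _ => (exp_pos _).le)]
  congr 1
  apply Complex.ofReal_injective
  rw [hval, Complex.ofReal_mul, Complex.ofReal_cpow (div_nonneg pi_pos.le hb.le)]
  push_cast
  simp

section ExponentialMoments

variable {Ω : Type*} [MeasurableSpace Ω] {μ : Measure Ω} {n : ℕ}
  {X : Ω → EuclideanSpace ℝ (Fin n)} {v : ℝ≥0}

namespace IsSubGaussianVector

/-- Normalize `g` and take `r = ‖g‖`; only `g = 0` has no direction. -/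
lemma lintegral_exp_inner_le [IsProbabilityMeasure μ] (hX : IsSubGaussianVector X v μ)
    (g : EuclideanSpace ℝ (Fin n)) :
    ∫⁻ ω, ENNReal.ofReal (Real.exp (inner ℝ (X ω) g)) ∂μ ≤
      ENNReal.ofReal (Real.exp (v * ‖g‖ ^ 2 / 2)) := by
  rcases eq_or_ne g 0 with rfl | hg
  · simp
  have hn : ‖g‖ ≠ 0 := norm_ne_zero_iff.mpr hg
  have h := hX.hasSubgaussianMGF_inner (‖g‖⁻¹ • g) (by
    rw [norm_smul, norm_inv, norm_norm, inv_mul_cancel₀ hn])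
  have heq : ∀ ω, ‖g‖ * inner ℝ (‖g‖⁻¹ • g) (X ω) = inner ℝ (X ω) g := fun ω => by
    rw [real_inner_smul_left, mul_inv_cancel_left₀ hn, real_inner_comm]
  have hint := h.integrable_exp_mul ‖g‖
  have hle := h.mgf_le ‖g‖
  simp only [mgf, heq] at hint hle
  rw [← ofReal_integral_eq_lintegral_ofReal hint (ae_of_all _ fun _ => (Real.exp_pos _).le)]
  exact ENNReal.ofReal_le_ofReal hle

/-- The exponential moment of `‖X‖ ^ 2`, bounded by averaging over an independent Gaussian
direction. -/
lemma lintegral_exp_sq_norm_le [IsProbabilityMeasure μ] (hX : IsSubGaussianVector X v μ)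
    {s : ℝ} (hs : s ^ 2 * v < 1) :
    ∫⁻ ω, ENNReal.ofReal (Real.exp (s ^ 2 / 2 * ‖X ω‖ ^ 2)) ∂μ ≤
      ENNReal.ofReal ((1 - s ^ 2 * v) ^ (-(n : ℝ) / 2)) := by
  have hb : 0 < (1 - s ^ 2 * v) / 2 := by linarith
  -- Total mass of the unnormalized weight `exp (-‖g‖² / 2)`.
  set C : ℝ := (Real.pi / (1 / 2)) ^ ((n : ℝ) / 2) with hC
  have hCpos : 0 < C := Real.rpow_pos_of_pos (by positivity) _
  have hgauss : ∀ ω, ENNReal.ofReal C * ENNReal.ofReal (Real.exp (s ^ 2 / 2 * ‖X ω‖ ^ 2)) =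
      ∫⁻ g : EuclideanSpace ℝ (Fin n),
        ENNReal.ofReal (Real.exp (-(1 / 2) * ‖g‖ ^ 2 + inner ℝ (s • X ω) g)) := fun ω => by
    rw [lintegral_exp_neg_mul_sq_norm_add_inner (by norm_num), ← ENNReal.ofReal_mul hCpos.le,
      norm_smul, mul_pow, Real.norm_eq_abs, sq_abs]
    congr 3
    ring
  have hmeas : AEMeasurable (Function.uncurry fun (ω : Ω) (g : EuclideanSpace ℝ (Fin n)) =>
      ENNReal.ofReal (Real.exp (-(1 / 2) * ‖g‖ ^ 2 + inner ℝ (s • X ω) g)))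
      (μ.prod volume) := by
    have h1 : AEMeasurable (fun p : Ω × EuclideanSpace ℝ (Fin n) => X p.1) (μ.prod volume) :=
      hX.aemeasurable.comp_quasiMeasurePreserving Measure.quasiMeasurePreserving_fst
    have h2 : AEMeasurable (fun p : Ω × EuclideanSpace ℝ (Fin n) => p.2) (μ.prod volume) :=
      measurable_snd.aemeasurable
    exact (((h2.norm.pow_const 2).const_mul _).add ((h1.const_smul s).inner h2)).exp.ennreal_ofReal
  have hinner : ∀ g : EuclideanSpace ℝ (Fin n),
      ∫⁻ ω, ENNReal.ofReal (Real.exp (-(1 / 2) * ‖g‖ ^ 2 + inner ℝ (s • X ω) g)) ∂μ ≤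
        -- The zero inner product lets the Laplace transform lemma apply again, with `w = 0`.
        ENNReal.ofReal (Real.exp (-((1 - s ^ 2 * v) / 2) * ‖g‖ ^ 2 + inner ℝ 0 g)) := fun g => by
    simp_rw [Real.exp_add, ENNReal.ofReal_mul (Real.exp_pos _).le]
    rw [lintegral_const_mul' _ _ ENNReal.ofReal_ne_top]
    simp_rw [real_inner_smul_left, ← real_inner_smul_right]
    refine (mul_le_mul_right (hX.lintegral_exp_inner_le (s • g)) _).trans_eq ?_
    rw [← ENNReal.ofReal_mul (Real.exp_pos _).le, ← ENNReal.ofReal_mul (Real.exp_pos _).le,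
      ← Real.exp_add, ← Real.exp_add, norm_smul, mul_pow, Real.norm_eq_abs, sq_abs,
      inner_zero_left]
    congr 2
    ring
  have hfinal : ENNReal.ofReal C * ∫⁻ ω, ENNReal.ofReal (Real.exp (s ^ 2 / 2 * ‖X ω‖ ^ 2)) ∂μ ≤
      ENNReal.ofReal C * ENNReal.ofReal ((1 - s ^ 2 * v) ^ (-(n : ℝ) / 2)) := by
    rw [← lintegral_const_mul' _ _ ENNReal.ofReal_ne_top]
    simp_rw [hgauss]
    rw [lintegral_lintegral_swap hmeas]
    refine (lintegral_mono hinner).trans_eq ?_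
    rw [lintegral_exp_neg_mul_sq_norm_add_inner hb, ← ENNReal.ofReal_mul hCpos.le, hC, neg_div,
      Real.rpow_neg (by linarith), ← Real.inv_rpow (by linarith),
      ← Real.mul_rpow (by positivity) (inv_nonneg.mpr (by linarith))]
    congr 1
    rw [norm_zero]
    simp only [ne_eq, OfNat.ofNat_ne_zero, not_false_eq_true, zero_pow, zero_div, Real.exp_zero,
      mul_one]
    congr 1
    field_simp
  rwa [ENNReal.mul_le_mul_iff_right (ENNReal.ofReal_pos.mpr hCpos).ne'
    ENNReal.ofReal_ne_top] at hfinal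

lemma integrable_exp_sq_norm [IsProbabilityMeasure μ] (hX : IsSubGaussianVector X v μ)
    {s : ℝ} (hs : s ^ 2 * v < 1) :
    Integrable (fun ω => Real.exp (s ^ 2 / 2 * ‖X ω‖ ^ 2)) μ := by
  refine ⟨((hX.aemeasurable.norm.pow_const 2).const_mul _).exp.aestronglyMeasurable, ?_⟩
  rw [hasFiniteIntegral_iff_ofReal (ae_of_all _ fun _ => (Real.exp_pos _).le)]
  exact (hX.lintegral_exp_sq_norm_le hs).trans_lt ENNReal.ofReal_lt_top

lemma integral_exp_sq_norm_le [IsProbabilityMeasure μ] (hX : IsSubGaussianVector X v μ)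
    {s : ℝ} (hs : s ^ 2 * v < 1) :
    ∫ ω, Real.exp (s ^ 2 / 2 * ‖X ω‖ ^ 2) ∂μ ≤ (1 - s ^ 2 * v) ^ (-(n : ℝ) / 2) := by
  rw [← ENNReal.ofReal_le_ofReal_iff (Real.rpow_nonneg (by linarith) _),
    ofReal_integral_eq_lintegral_ofReal (hX.integrable_exp_sq_norm hs)
      (ae_of_all _ fun _ => (Real.exp_pos _).le)]
  exact hX.lintegral_exp_sq_norm_le hs

end IsSubGaussianVector

end ExponentialMoments

theorem mainTheorem1 {Ω : Type*} [MeasurableSpace Ω] (μ : Measure Ω) [IsProbabilityMeasure μ]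
    (n : ℕ) (X : Ω → EuclideanSpace ℝ (Fin n)) (σ : ℝ≥0) (hσ : 0 < σ)
    (hX : IsSubGaussianVector X (σ ^ 2) μ) :
    (∀ δ ∈ Set.Ioo (0 : ℝ) 1, ∀ ε ∈ Set.Ioo (0 : ℝ) 1,
      1 - δ ≤ μ.real {ω | ‖X ω‖ ≤ (σ : ℝ) *
        Real.sqrt (Real.log (1 / (1 - ε ^ 2)) / ε ^ 2 * (n : ℝ)
          + 2 / ε ^ 2 * Real.log (1 / δ))}) ∧
    (∀ ε ∈ Set.Ioo (0 : ℝ) 1, ∀ t : ℝ,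
      Integrable (fun ω => Real.exp (t * ‖X ω‖)) μ ∧
      ∫ ω, Real.exp (t * ‖X ω‖) ∂μ ≤
        (1 - ε ^ 2) ^ (-(n : ℝ) / 2) * Real.exp ((σ : ℝ) ^ 2 * t ^ 2 / (2 * ε ^ 2))) := by
  have hσ' : (0 : ℝ) < σ := hσ
  have hs : ∀ ε : ℝ, (ε / σ) ^ 2 * ((σ ^ 2 : ℝ≥0) : ℝ) = ε ^ 2 := fun ε => by
    push_cast
    field_simp
  have hlt : ∀ ε ∈ Set.Ioo (0 : ℝ) 1, (ε / σ) ^ 2 * ((σ ^ 2 : ℝ≥0) : ℝ) < 1 := fun ε hε => by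
    rw [hs]
    exact pow_lt_one₀ hε.1.le hε.2 two_ne_zero
  constructor
  · intro δ hδ ε hε
    have hε0 := hε.1
    have hε1 : 0 < 1 - ε ^ 2 := by have := hlt ε hε; rw [hs] at this; linarith
    set R := Real.log (1 / (1 - ε ^ 2)) / ε ^ 2 * (n : ℝ) + 2 / ε ^ 2 * Real.log (1 / δ) with hR
    have hR0 : 0 ≤ R := by
      have h1 : 0 ≤ Real.log (1 / (1 - ε ^ 2)) :=
        Real.log_nonneg (by rw [le_div_iff₀ hε1]; nlinarith)
      have h2 : 0 ≤ Real.log (1 / δ) :=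
        Real.log_nonneg (by rw [le_div_iff₀ hδ.1]; linarith [hδ.2])
      positivity
    -- `R` is chosen so that Markov's bound is exactly `δ`.
    have hexp : Real.exp ((ε / σ) ^ 2 / 2 * ((σ : ℝ) * √R) ^ 2) * δ =
        (1 - ε ^ 2) ^ (-(n : ℝ) / 2) := by
      rw [mul_pow, Real.sq_sqrt hR0, Real.rpow_def_of_pos hε1]
      conv_lhs => rw [← Real.exp_log hδ.1, ← Real.exp_add]
      congr 1
      rw [hR, one_div, one_div, Real.log_inv, Real.log_inv]
      field_simp
      ring
    have hmarkov := (mul_meas_ge_le_integral_of_nonneg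
      (ae_of_all μ fun ω => (Real.exp_pos ((ε / σ) ^ 2 / 2 * ‖X ω‖ ^ 2)).le)
      (hX.integrable_exp_sq_norm (hlt ε hε))
      (Real.exp ((ε / σ) ^ 2 / 2 * ((σ : ℝ) * √R) ^ 2))).trans
      (hX.integral_exp_sq_norm_le (hlt ε hε))
    rw [hs, ← hexp] at hmarkov
    have htail := le_of_mul_le_mul_left hmarkov (Real.exp_pos _)
    -- Subadditivity over a cover avoids complements, as `X` is only a.e. measurable.
    have hcover : (Set.univ : Set Ω) ⊆ {ω | ‖X ω‖ ≤ (σ : ℝ) * √R} ∪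
        {ω | Real.exp ((ε / σ) ^ 2 / 2 * ((σ : ℝ) * √R) ^ 2) ≤
          Real.exp ((ε / σ) ^ 2 / 2 * ‖X ω‖ ^ 2)} := by
      intro ω _
      rcases le_total ‖X ω‖ ((σ : ℝ) * √R) with h | h
      · exact Or.inl h
      · refine Or.inr (Real.exp_le_exp.mpr ?_)
        gcongr
    have hone := (measureReal_mono (μ := μ) hcover).trans (measureReal_union_le _ _)
    rw [probReal_univ] at hone
    linarith
  · intro ε hε t
    have hε0 := hε.1
    have hle : ∀ ω, Real.exp (t * ‖X ω‖) ≤ Real.exp ((ε / σ) ^ 2 / 2 * ‖X ω‖ ^ 2) *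
        Real.exp ((σ : ℝ) ^ 2 * t ^ 2 / (2 * ε ^ 2)) := fun ω => by
      rw [← Real.exp_add, Real.exp_le_exp, ← sub_nonneg]
      -- Young's inequality by completing the square.
      have : (ε / σ) ^ 2 / 2 * ‖X ω‖ ^ 2 + (σ : ℝ) ^ 2 * t ^ 2 / (2 * ε ^ 2) - t * ‖X ω‖ =
          (ε / σ * ‖X ω‖ - σ * t / ε) ^ 2 / 2 := by
        field_simp
        ring
      rw [this]
      positivity
    have hdom := (hX.integrable_exp_sq_norm (hlt ε hε)).mul_const
      (Real.exp ((σ : ℝ) ^ 2 * t ^ 2 / (2 * ε ^ 2)))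
    have hint : Integrable (fun ω => Real.exp (t * ‖X ω‖)) μ :=
      hdom.mono' (hX.aemeasurable.norm.const_mul t).exp.aestronglyMeasurable
        (ae_of_all _ fun ω => by
          rw [Real.norm_eq_abs, Real.abs_exp]
          exact hle ω)
    refine ⟨hint, (integral_mono hint hdom hle).trans ?_⟩
    rw [integral_mul_const]
    have := hX.integral_exp_sq_norm_le (hlt ε hε)
    rw [hs] at this
    gcongr
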